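/- Let $\theta>1$ be a real number and $s\ge 1$ an integer. For each $N$ let $\pi\in S_N$ be drawn from the Mallows distribution $\Pr(\pi)=\theta^{\mathrm{inv}(\pi)}/\sum_{\tau\in S_N}\theta^{\mathrm{inv}(\tau)}$, where $\mathrm{inv}$ counts inversions. The candidates with ranks $\pi(1),\dots,\pi(N)$ are presented one by one in this order; $N$ is the best rank. For integers $0\le k_1\le\dots\le k_s$, the $(k_1,\dots,k_s)$-strategy makes at most $s$ selections: for $i=1,\dots,s$, the $i$-th selection is the first candidate after the $(i-1)$-th selection whose position is larger than $k_i$ and who is better than all the candidates presented earlier (there is no $i$-th selection if there is no such candidate). The strategy wins if one of its selections is the candidate of rank $N$; let $p_N(k_1,\dots,k_s)$ be the probability of winning. Call a sequence of threshold vectors $\bigl(k_1(N)\le\dots\le k_s(N)\bigr)_N$ asymptotically optimal if for every $\varepsilon>0$ and all sufficiently large $N$, $$p_N(l_1,\dots,l_s)\le p_N\bigl(k_1(N),\dots,k_s(N)\bigr)+\varepsilon\quad\text{for all integers } 0\le l_1\le\dots\le l_s .$$ Then, for every asymptotically optimal sequence, $k_s(N)$ does not tend to $\infty$ as $N\to\infty$;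 indeed it stays bounded: there is $B$ (which may depend on the sequence) such that $k_i(N)\le B$ for all $N$ and all $1\le i\le s$. -/

import Mathlib

/-- The Kendall statistic of `π`: the number of pairs of positions `i < j` with `π i > π j`.
A permutation lists the candidates in order of interview: the `p`-th entry (positions are numbered
`0, …, N - 1`) is the rank `π p` among `0, …, N - 1`, a higher rank being better. -/
def inversionCount {N : ℕ} (π : Equiv.Perm (Fin N)) : ℕ :=
  (Finset.univ.filter fun x : Fin N × Fin N => x.1 < x.2 ∧ π x.2 < π x.1).card

/-- The candidate at position `p` is a left-to-right maximum. -/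
def IsLeftToRightMax {N : ℕ} (π : Equiv.Perm (Fin N)) (p : Fin N) : Prop :=
  ∀ q : Fin N, q < p → π q < π p

instance {N : ℕ} (π : Equiv.Perm (Fin N)) (p : Fin N) : Decidable (IsLeftToRightMax π p) :=
  inferInstanceAs (Decidable (∀ q : Fin N, q < p → π q < π p))

/-- If `c` selections have been made before position `p`, the strategy with thresholds
`k 0, …, k (s - 1)` selects the candidate at position `p`: a selection is left, the first `k c`
candidates (positions `0, …, k c - 1`) are past, and the candidate is a left-to-right maximum. -/
def Accepts {N s : ℕ} (k : Fin s → ℕ) (π : Equiv.Perm (Fin N)) (c : ℕ) (p : Fin N) : Prop :=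
  ∃ hc : c < s, k ⟨c, hc⟩ ≤ (p : ℕ) ∧ IsLeftToRightMax π p

instance {N s : ℕ} (k : Fin s → ℕ) (π : Equiv.Perm (Fin N)) (c : ℕ) (p : Fin N) :
    Decidable (Accepts k π c p) :=
  inferInstanceAs (Decidable (∃ hc : c < s, k ⟨c, hc⟩ ≤ (p : ℕ) ∧ IsLeftToRightMax π p))

/-- The number of selections that the threshold strategy makes among the first `m` candidates. -/
def selectionCount {N s : ℕ} (k : Fin s → ℕ) (π : Equiv.Perm (Fin N)) : ℕ → ℕ
  | 0 => 0
  | m + 1 =>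
    if ∃ hm : m < N, Accepts k π (selectionCount k π m) ⟨m, hm⟩ then
      selectionCount k π m + 1
    else selectionCount k π m

/-- The threshold strategy selects the candidate at position `p` of `π`. -/
def Selects {N s : ℕ} (k : Fin s → ℕ) (π : Equiv.Perm (Fin N)) (p : Fin N) : Prop :=
  Accepts k π (selectionCount k π p) p

instance {N s : ℕ} (k : Fin s → ℕ) (π : Equiv.Perm (Fin N)) (p : Fin N) :
    Decidable (Selects k π p) :=
  inferInstanceAs (Decidable (Accepts k π (selectionCount k π p) p))

/-- `π` is `k`-winnable: one of the selected candidates is the best of all `N` candidates. -/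
def Winnable {N s : ℕ} (k : Fin s → ℕ) (π : Equiv.Perm (Fin N)) : Prop :=
  ∃ p : Fin N, Selects k π p ∧ (π p : ℕ) + 1 = N

instance {N s : ℕ} (k : Fin s → ℕ) (π : Equiv.Perm (Fin N)) : Decidable (Winnable k π) :=
  inferInstanceAs (Decidable (∃ p : Fin N, Selects k π p ∧ (π p : ℕ) + 1 = N))

/-- The probability of `π` under the Mallows distribution with parameter `θ` on permutations of
`N` candidates. -/
noncomputable def mallowsProb (θ : ℝ) {N : ℕ} (π : Equiv.Perm (Fin N)) : ℝ :=
  θ ^ inversionCount π / ∑ τ : Equiv.Perm (Fin N), θ ^ inversionCount τ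

/-- The probability that the strategy with thresholds `k` wins with `N` candidates. -/
noncomputable def winProb (θ : ℝ) (N : ℕ) {s : ℕ} (k : Fin s → ℕ) : ℝ :=
  ∑ π : Equiv.Perm (Fin N) with Winnable k π, mallowsProb θ π

/-- The threshold strategies `k N` (`N` being the number of candidates) are asymptotically optimal:
up to an error that tends to `0` as `N → ∞`, no `s`-threshold strategy for `N` candidates has a
larger probability of winning than `k N`. -/
def AsymptoticallyOptimal (θ : ℝ) {s : ℕ} (k : ℕ → Fin s → ℕ) : Prop :=
  ∀ ε : ℝ, 0 < ε → ∀ᶠ N : ℕ in Filter.atTop,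
    ∀ l : Fin s → ℕ, Monotone l → winProb θ N l ≤ winProb θ N (k N) + ε

/-! Building a permutation by appending its last relative rank shows that the left-to-right maxima
(records) occur independently, at position `p` with probability `1 / (1 + θ + ⋯ + θ ^ p)`
(`sum_mallowsProb_mul_prod`). These probabilities are summable, so records beyond a large `B` are
rare, uniformly in `N`.

If the last threshold is large, replace the thresholds by `(0, k₁, …, k_{s-1})`. The new strategy is
never behind and at most one selection ahead, so it can lose a win only when the old one wins with
its last selection, at a record beyond `B`. It gains when the records are exactly `0, …, i`, with
`i` the least index such that `i < k i`: the old strategy uses up `0, …, i - 1` and passes over the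
best candidate, the new one takes it. This event has probability at least some `δ > 0` independent
of `N` and `i`, which contradicts asymptotic optimality. -/

open Finset

/-! ### Inversions and records when a last entry is appended. -/

section Insertion

/-- The permutation of `n + 1` candidates whose last entry is `a` and whose other entries are in the
same relative order as those of `σ`. -/
def appendLast {n : ℕ} (a : Fin (n + 1)) (σ : Equiv.Perm (Fin n)) : Equiv.Perm (Fin (n + 1)) :=
  (finSuccEquiv' (Fin.last n)).trans ((Equiv.optionCongr σ).trans (finSuccEquiv' a).symm)

@[simp]
theorem appendLast_last {n : ℕ} (a : Fin (n + 1)) (σ : Equiv.Perm (Fin n)) :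
    appendLast a σ (Fin.last n) = a := by
  simp [appendLast]

@[simp]
theorem appendLast_castSucc {n : ℕ} (a : Fin (n + 1)) (σ : Equiv.Perm (Fin n)) (i : Fin n) :
    appendLast a σ i.castSucc = a.succAbove (σ i) := by
  have h : finSuccEquiv' (Fin.last n) i.castSucc = some i := by
    rw [← Fin.succAbove_last_apply, finSuccEquiv'_succAbove]
  simp [appendLast, h]

theorem appendLast_bijective (n : ℕ) :
    Function.Bijective (fun x : Fin (n + 1) × Equiv.Perm (Fin n) => appendLast x.1 x.2) := by
  rw [Fintype.bijective_iff_injective_and_card]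
  constructor
  · rintro ⟨a, σ⟩ ⟨b, τ⟩ h
    have hab : a = b := by
      have := congrArg (fun π : Equiv.Perm (Fin (n + 1)) => π (Fin.last n)) h
      simpa using this
    subst hab
    refine Prod.ext rfl (Equiv.ext fun i => ?_)
    have := congrArg (fun π : Equiv.Perm (Fin (n + 1)) => π i.castSucc) h
    simpa using this
  · simp [Fintype.card_perm, Nat.factorial_succ]

theorem inversionCount_eq_sum {N : ℕ} (π : Equiv.Perm (Fin N)) :
    inversionCount π = ∑ j : Fin N, ∑ i : Fin N, if i < j ∧ π j < π i then 1 else 0 := by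
  rw [inversionCount, Finset.card_filter, Fintype.sum_prod_type_right]

/-- `a.succAbove` preserves order, so old pairs are unaffected; the new inversions come from the `n
- a` values above `a`. -/
theorem inversionCount_appendLast {n : ℕ} (a : Fin (n + 1)) (σ : Equiv.Perm (Fin n)) :
    inversionCount (appendLast a σ) = inversionCount σ + (n - a) := by
  rw [inversionCount_eq_sum, inversionCount_eq_sum, Fin.sum_univ_castSucc]
  congr 1
  · refine Finset.sum_congr rfl fun j _ => ?_
    rw [Fin.sum_univ_castSucc]
    simp [(Fin.castSucc_lt_last j).not_gt, (Fin.strictMono_succAbove a).lt_iff_lt]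
  · rw [Fin.sum_univ_castSucc]
    simp only [Fin.castSucc_lt_last, appendLast_last, appendLast_castSucc, true_and, lt_irrefl,
      false_and, if_false, add_zero]
    rw [Equiv.sum_comp σ (fun i => if a < a.succAbove i then 1 else 0)]
    simp only [Fin.lt_succAbove_iff_le_castSucc, Fin.le_def, Fin.val_castSucc]
    rw [Fin.sum_univ_eq_sum_range (fun i => if (a : ℕ) ≤ i then 1 else 0) n, ← Finset.card_filter]
    have : (range n).filter (fun i => (a : ℕ) ≤ i) = Ico (a : ℕ) n := by
      ext; simp; omega
    rw [this, Nat.card_Ico]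

theorem isLeftToRightMax_appendLast_castSucc {n : ℕ} (a : Fin (n + 1)) (σ : Equiv.Perm (Fin n))
    (p : Fin n) :
    IsLeftToRightMax (appendLast a σ) p.castSucc ↔ IsLeftToRightMax σ p := by
  constructor
  · intro h q hq
    simpa using h q.castSucc (by simpa using hq)
  · intro h q hq
    induction q using Fin.lastCases with
    | last => exact absurd hq (not_lt.2 (Fin.le_last _))
    | cast q => simpa using h q (by simpa using hq)

theorem isLeftToRightMax_appendLast_last {n : ℕ} (a : Fin (n + 1)) (σ : Equiv.Perm (Fin n)) :
    IsLeftToRightMax (appendLast a σ) (Fin.last n) ↔ a = Fin.last n := by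
  constructor
  · intro h
    by_contra ha
    obtain ⟨q, hq⟩ := (appendLast a σ).surjective (Fin.last n)
    induction q using Fin.lastCases with
    | last => exact ha (by simpa using hq)
    | cast q =>
      have := h q.castSucc (Fin.castSucc_lt_last q)
      rw [hq] at this
      exact absurd this (not_lt.2 (Fin.le_last _))
  · rintro rfl q hq
    induction q using Fin.lastCases with
    | last => exact absurd hq (lt_irrefl _)
    | cast q => simp [Fin.castSucc_lt_last]

end Insertion

/-! ### Independence of records and bounds on their probabilities. -/

section Weights

/-- The total weight of the values with which the candidate at position `p` is not a left-to-right
maximum, relative to the weight of the value with which it is one. -/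
noncomputable def nonRecordWeight (θ : ℝ) (p : ℕ) : ℝ := ∑ j ∈ range p, θ ^ (p - j)

/-- The left-to-right maxima are independent under the Mallows distribution: the generating function
of their indicators is a product. -/
theorem sum_pow_inversionCount_mul_prod (θ : ℝ) (u v : ℕ → ℝ) (N : ℕ) :
    ∑ π : Equiv.Perm (Fin N), θ ^ inversionCount π *
        ∏ p : Fin N, (if IsLeftToRightMax π p then u p else v p) =
      ∏ p ∈ range N, (u p + nonRecordWeight θ p * v p) := by
  induction N with
  | zero => simp [inversionCount]
  | succ n ih =>
    rw [← (appendLast_bijective n).sum_comp, Fintype.sum_prod_type, prod_range_succ, ← ih,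
      Finset.sum_comm, Finset.sum_mul]
    refine Finset.sum_congr rfl fun σ _ => ?_
    simp only [Fin.prod_univ_castSucc, isLeftToRightMax_appendLast_castSucc,
      isLeftToRightMax_appendLast_last, inversionCount_appendLast, pow_add, Fin.val_castSucc,
      Fin.val_last]
    -- Only the top value makes the last position a record, and it adds no inversions.
    rw [Fin.sum_univ_castSucc]
    simp only [Fin.val_last, Fin.val_castSucc, Nat.sub_self, pow_zero, if_true,
      (Fin.castSucc_lt_last _).ne, if_false]
    rw [nonRecordWeight, ← Fin.sum_univ_eq_sum_range (fun j => θ ^ (n - j)) n, mul_add,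
      Finset.sum_mul, Finset.mul_sum, add_comm]
    congr 1
    · ring
    · exact Finset.sum_congr rfl fun j _ => by ring

/-- The probability that the candidate at position `p` is a left-to-right maximum. -/
noncomputable def recordProb (θ : ℝ) (p : ℕ) : ℝ := (1 + nonRecordWeight θ p)⁻¹

theorem nonRecordWeight_nonneg {θ : ℝ} (hθ : 1 < θ) (p : ℕ) : 0 ≤ nonRecordWeight θ p :=
  Finset.sum_nonneg fun _ _ => by positivity

theorem pow_le_one_add_nonRecordWeight {θ : ℝ} (hθ : 1 < θ) (p : ℕ) :
    θ ^ p ≤ 1 + nonRecordWeight θ p := by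
  rcases Nat.eq_zero_or_pos p with rfl | hp
  · simp [nonRecordWeight]
  · have : θ ^ (p - 0) ≤ nonRecordWeight θ p :=
      Finset.single_le_sum (f := fun j => θ ^ (p - j)) (fun _ _ => by positivity)
        (mem_range.2 hp)
    simp only [Nat.sub_zero] at this
    linarith

theorem recordProb_pos {θ : ℝ} (hθ : 1 < θ) (p : ℕ) : 0 < recordProb θ p := by
  have := nonRecordWeight_nonneg hθ p
  unfold recordProb
  positivity

theorem recordProb_le {θ : ℝ} (hθ : 1 < θ) (p : ℕ) : recordProb θ p ≤ θ⁻¹ ^ p := by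
  rw [inv_pow]
  exact inv_anti₀ (by positivity) (pow_le_one_add_nonRecordWeight hθ p)

@[simp]
theorem recordProb_zero (θ : ℝ) : recordProb θ 0 = 1 := by simp [recordProb, nonRecordWeight]

theorem recordProb_le_one {θ : ℝ} (hθ : 1 < θ) (p : ℕ) : recordProb θ p ≤ 1 :=
  inv_le_one_of_one_le₀ (by linarith [nonRecordWeight_nonneg hθ p])

theorem recordProb_lt_one {θ : ℝ} (hθ : 1 < θ) {p : ℕ} (hp : p ≠ 0) : recordProb θ p < 1 :=
  (recordProb_le hθ p).trans_lt (pow_lt_one₀ (by positivity) (inv_lt_one_of_one_lt₀ hθ) hp)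

/-- Taking `u = v = 1` in the unnormalized identity evaluates the partition function; divide factor
by factor. -/
theorem sum_mallowsProb_mul_prod {θ : ℝ} (hθ : 1 < θ) (u v : ℕ → ℝ) (N : ℕ) :
    ∑ π : Equiv.Perm (Fin N), mallowsProb θ π *
        ∏ p : Fin N, (if IsLeftToRightMax π p then u p else v p) =
      ∏ p ∈ range N, (recordProb θ p * u p + (1 - recordProb θ p) * v p) := by
  have hZ := sum_pow_inversionCount_mul_prod θ (fun _ => 1) (fun _ => 1) N
  simp only [ite_self, prod_const_one, mul_one] at hZ
  simp only [mallowsProb, hZ, div_mul_eq_mul_div]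
  rw [← Finset.sum_div, sum_pow_inversionCount_mul_prod, ← Finset.prod_div_distrib]
  refine Finset.prod_congr rfl fun p _ => ?_
  have := nonRecordWeight_nonneg hθ p
  have h : 1 + nonRecordWeight θ p ≠ 0 := by positivity
  rw [recordProb]
  field_simp
  ring

theorem mallowsProb_nonneg {θ : ℝ} (hθ : 1 < θ) {N : ℕ} (π : Equiv.Perm (Fin N)) :
    0 ≤ mallowsProb θ π :=
  div_nonneg (by positivity) (Finset.sum_nonneg fun _ _ => by positivity)

theorem sum_mallowsProb {θ : ℝ} (hθ : 1 < θ) (N : ℕ) :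
    ∑ π : Equiv.Perm (Fin N), mallowsProb θ π = 1 := by
  simpa using sum_mallowsProb_mul_prod hθ (fun _ => 1) (fun _ => 1) N

theorem one_sub_sum_le_prod_one_sub {ι : Type*} (t : Finset ι) (f : ι → ℝ)
    (h0 : ∀ i ∈ t, 0 ≤ f i) (h1 : ∀ i ∈ t, f i ≤ 1) :
    1 - ∑ i ∈ t, f i ≤ ∏ i ∈ t, (1 - f i) := by
  classical
  induction t using Finset.induction_on with
  | empty => simp
  | insert a t ha ih =>
    rw [sum_insert ha, prod_insert ha]
    have hi := ih (fun i hi => h0 i (mem_insert_of_mem hi)) (fun i hi => h1 i (mem_insert_of_mem hi))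
    have ha0 := h0 a (mem_insert_self _ _)
    have ha1 := h1 a (mem_insert_self _ _)
    have hs : 0 ≤ ∑ i ∈ t, f i := Finset.sum_nonneg fun i hi => h0 i (mem_insert_of_mem hi)
    nlinarith [mul_le_mul_of_nonneg_left hi (sub_nonneg.2 ha1), mul_nonneg ha0 hs]

theorem exists_sum_recordProb_le {θ : ℝ} (hθ : 1 < θ) {ε : ℝ} (hε : 0 < ε) :
    ∃ B, ∀ b N, B ≤ b → ∑ p ∈ Ico b N, recordProb θ p ≤ ε := by
  have hs : Summable (recordProb θ) :=
    Summable.of_nonneg_of_le (fun p => (recordProb_pos hθ p).le) (recordProb_le hθ)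
      (summable_geometric_of_lt_one (by positivity) (inv_lt_one_of_one_lt₀ hθ))
  obtain ⟨s, hs⟩ := summable_iff_vanishing_norm.1 hs ε hε
  refine ⟨s.sup id + 1, fun b N hb => (le_abs_self _).trans (hs _ ?_).le⟩
  rw [Finset.disjoint_left]
  intro x hx hxs
  have : x ≤ s.sup id := Finset.le_sup (f := id) hxs
  have := (mem_Ico.1 hx).1
  omega

/-- The probability that there is a left-to-right maximum at or after position `B`. -/
theorem sum_mallowsProb_exists_le {θ : ℝ} (hθ : 1 < θ) (N B : ℕ) :
    ∑ π : Equiv.Perm (Fin N) with ∃ p : Fin N, B ≤ (p : ℕ) ∧ IsLeftToRightMax π p, mallowsProb θ π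
      ≤ ∑ p ∈ Ico B N, recordProb θ p := by
  -- With these weights the product is the indicator that no record occurs from `B` on.
  have hprod := sum_mallowsProb_mul_prod hθ (fun p => if B ≤ p then 0 else 1) (fun _ => 1) N
  have hfilter : ∑ p ∈ Ico B N, recordProb θ p =
      ∑ p ∈ range N, if B ≤ p then recordProb θ p else 0 := by
    rw [← Finset.sum_filter]
    congr 1
    ext; simp; omega
  have hle := one_sub_sum_le_prod_one_sub (range N) (fun p => if B ≤ p then recordProb θ p else 0)
    (fun p _ => by split_ifs <;> simp [(recordProb_pos hθ p).le])
    (fun p _ => by split_ifs <;> simp [recordProb_le_one hθ p])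
  have hcongr : ∏ p ∈ range N, (1 - if B ≤ p then recordProb θ p else 0) =
      ∏ p ∈ range N, (recordProb θ p * (if B ≤ p then 0 else 1) + (1 - recordProb θ p) * 1) :=
    Finset.prod_congr rfl fun p _ => by split_ifs <;> ring
  rw [hcongr, ← hprod, ← hfilter, sub_le_iff_le_add, ← sub_le_iff_le_add'] at hle
  nth_rewrite 1 [← sum_mallowsProb hθ N] at hle
  rw [← Finset.sum_sub_distrib] at hle
  refine le_trans ?_ hle
  rw [Finset.sum_filter]
  refine Finset.sum_le_sum fun π _ => ?_
  split_ifs with h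
  · obtain ⟨p, hp, hm⟩ := h
    rw [Finset.prod_eq_zero (mem_univ p) (by simp [hp, hm])]
    simp
  · push Not at h
    rw [Finset.prod_eq_one]
    · simp
    · intro p _
      split_ifs with h1 h2
      · exact absurd h1 (h p h2)
      · rfl
      · rfl

/-- The probability that the left-to-right maxima are exactly the positions `0, …, i`. -/
theorem sum_mallowsProb_initial {θ : ℝ} (hθ : 1 < θ) (N i : ℕ) :
    ∑ π : Equiv.Perm (Fin N) with ∀ p : Fin N, IsLeftToRightMax π p ↔ (p : ℕ) ≤ i, mallowsProb θ π
      = ∏ p ∈ range N, if p ≤ i then recordProb θ p else 1 - recordProb θ p := by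
  have hprod := sum_mallowsProb_mul_prod hθ (fun p => if p ≤ i then 1 else 0)
    (fun p => if p ≤ i then 0 else 1) N
  have hcongr : ∏ p ∈ range N, (if p ≤ i then recordProb θ p else 1 - recordProb θ p) =
      ∏ p ∈ range N, (recordProb θ p * (if p ≤ i then 1 else 0) +
        (1 - recordProb θ p) * (if p ≤ i then 0 else 1)) :=
    Finset.prod_congr rfl fun p _ => by split_ifs <;> ring
  rw [hcongr, ← hprod, Finset.sum_filter]
  refine Finset.sum_congr rfl fun π _ => ?_
  split_ifs with h
  · rw [Finset.prod_eq_one]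
    · simp
    · intro p _
      by_cases hp : (p : ℕ) ≤ i
      · simp [hp, (h p).2 hp]
      · simp [hp, mt (h p).1 hp]
  · push Not at h
    obtain ⟨p, hp⟩ := h
    rw [Finset.prod_eq_zero (mem_univ p), mul_zero]
    rcases hp with ⟨h1, h2⟩ | ⟨h1, h2⟩
    · simp [h1, h2]
    · simp [h1, h2]

/-- The probability that the left-to-right maxima are exactly the positions `0, …, i` is bounded
below, uniformly in `N` and in `i < s`. -/
theorem exists_le_sum_mallowsProb_initial {θ : ℝ} (hθ : 1 < θ) (s : ℕ) :
    ∃ δ : ℝ, 0 < δ ∧ ∃ M, ∀ N, M ≤ N → ∀ i < s,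
      δ ≤ ∑ π : Equiv.Perm (Fin N) with ∀ p : Fin N, IsLeftToRightMax π p ↔ (p : ℕ) ≤ i,
        mallowsProb θ π := by
  obtain ⟨B, hB⟩ := exists_sum_recordProb_le hθ (ε := 1 / 2) (by norm_num)
  -- Position `0` is always a record, so there the minimum would vanish; its factor is `1` for every
  -- `i`.
  have hpos : ∀ p, 0 < if p = 0 then 1 else min (recordProb θ p) (1 - recordProb θ p) := by
    intro p
    split_ifs with hp
    · exact one_pos
    · exact lt_min (recordProb_pos hθ p) (sub_pos.2 (recordProb_lt_one hθ hp))
  refine ⟨(∏ p ∈ range (max B s), if p = 0 then 1 else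
    min (recordProb θ p) (1 - recordProb θ p)) * (1 / 2),
    mul_pos (Finset.prod_pos fun p _ => hpos p) (by norm_num), max B s, fun N hN i hi => ?_⟩
  rw [sum_mallowsProb_initial hθ, ← Finset.prod_range_mul_prod_Ico _ hN]
  have hfst : (∏ p ∈ range (max B s), if p = 0 then 1 else
      min (recordProb θ p) (1 - recordProb θ p)) ≤
      ∏ p ∈ range (max B s), if p ≤ i then recordProb θ p else 1 - recordProb θ p := by
    refine Finset.prod_le_prod (fun p _ => (hpos p).le) fun p _ => ?_
    by_cases hp : p = 0
    · simp [hp]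
    · rw [if_neg hp]
      split_ifs
      · exact min_le_left _ _
      · exact min_le_right _ _
  refine mul_le_mul hfst ?_ (by norm_num)
    ((Finset.prod_nonneg fun p _ => (hpos p).le).trans hfst)
  have htail := one_sub_sum_le_prod_one_sub (Ico (max B s) N) (recordProb θ)
    (fun p _ => (recordProb_pos hθ p).le) (fun p _ => recordProb_le_one hθ p)
  have hsum := hB (max B s) N (le_max_left _ _)
  calc (1 / 2 : ℝ) ≤ ∏ p ∈ Ico (max B s) N, (1 - recordProb θ p) := by linarith
    _ = _ := Finset.prod_congr rfl fun p hp => by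
      have := (mem_Ico.1 hp).1
      rw [if_neg]
      have := le_max_right B s
      omega

end Weights

/-! ### Comparison of a strategy with its shift. -/

section Strategies

variable {N s : ℕ}

/-- The thresholds `(0, k₁, …, k_{s-1})`. -/
def shiftThresholds (k : Fin s → ℕ) (i : Fin s) : ℕ :=
  if (i : ℕ) = 0 then 0 else k ⟨i - 1, by omega⟩

theorem shiftThresholds_succ (k : Fin s → ℕ) {c : ℕ} (hc : c + 1 < s) :
    shiftThresholds k ⟨c + 1, hc⟩ = k ⟨c, by omega⟩ := by
  simp [shiftThresholds]

theorem monotone_shiftThresholds {k : Fin s → ℕ} (hk : Monotone k) :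
    Monotone (shiftThresholds k) := by
  intro i j hij
  have : (i : ℕ) ≤ j := hij
  unfold shiftThresholds
  split_ifs
  · exact le_rfl
  · exact Nat.zero_le _
  · omega
  · exact hk (by rw [Fin.le_def]; simp only; omega)

theorem shiftThresholds_le {k : Fin s → ℕ} (hk : Monotone k) (i : Fin s) :
    shiftThresholds k i ≤ k i := by
  unfold shiftThresholds
  split_ifs
  · exact Nat.zero_le _
  · exact hk (by rw [Fin.le_def]; simp only; omega)

theorem accepts_shiftThresholds_of_accepts {k : Fin s → ℕ} (hk : Monotone k)
    {π : Equiv.Perm (Fin N)} {c : ℕ} {p : Fin N} (h : Accepts k π c p) :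
    Accepts (shiftThresholds k) π c p := by
  obtain ⟨hc, hp, hm⟩ := h
  exact ⟨hc, (shiftThresholds_le hk _).trans hp, hm⟩

theorem accepts_shiftThresholds_succ_iff (k : Fin s → ℕ) (π : Equiv.Perm (Fin N)) (c : ℕ)
    (p : Fin N) :
    Accepts (shiftThresholds k) π (c + 1) p ↔ c + 1 < s ∧ Accepts k π c p := by
  constructor
  · rintro ⟨hc, hp, hm⟩
    rw [shiftThresholds_succ] at hp
    exact ⟨hc, by omega, hp, hm⟩
  · rintro ⟨hc, _, hp, hm⟩
    exact ⟨hc, by rwa [shiftThresholds_succ], hm⟩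

/-- The shifted strategy is always level with the original one or one selection ahead of it. -/
theorem selectionCount_shiftThresholds {k : Fin s → ℕ} (hk : Monotone k) (π : Equiv.Perm (Fin N))
    (m : ℕ) :
    selectionCount (shiftThresholds k) π m = selectionCount k π m ∨
      selectionCount (shiftThresholds k) π m = selectionCount k π m + 1 := by
  induction m with
  | zero => simp [selectionCount]
  | succ m ih =>
    simp only [selectionCount]
    rcases ih with ih | ih
    · rw [ih]
      split_ifs with h1 h2 h2
      · simp
      · simp
      · obtain ⟨hm, h⟩ := h2
        exact absurd ⟨hm, accepts_shiftThresholds_of_accepts hk h⟩ h1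
      · simp
    -- One ahead, the shifted strategy faces the threshold the original faces now, so its lead
    -- cannot grow.
    · rw [ih]
      split_ifs with h1 h2 h2
      · simp
      · obtain ⟨hm, h⟩ := h1
        exact absurd ⟨hm, ((accepts_shiftThresholds_succ_iff k π _ _).1 h).2⟩ h2
      · simp
      · simp

/-- Unless the winning selection is the last one allowed, a strategy one ahead still has a selection
left for it. -/
theorem winnable_shiftThresholds_or {k : Fin s → ℕ} (hk : Monotone k) {π : Equiv.Perm (Fin N)}
    {B : ℕ} (hB : ∀ i : Fin s, (i : ℕ) + 1 = s → B ≤ k i) (h : Winnable k π) :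
    Winnable (shiftThresholds k) π ∨ ∃ p : Fin N, B ≤ (p : ℕ) ∧ IsLeftToRightMax π p := by
  obtain ⟨p, hsel, hp⟩ := h
  by_cases hc : selectionCount k π p + 1 < s
  · refine Or.inl ⟨p, ?_, hp⟩
    unfold Selects
    rcases selectionCount_shiftThresholds hk π p with h | h
    · rw [h]
      exact accepts_shiftThresholds_of_accepts hk hsel
    · rw [h]
      exact (accepts_shiftThresholds_succ_iff k π _ _).2 ⟨hc, hsel⟩
  · obtain ⟨hlt, hle, hm⟩ := hsel
    exact Or.inr ⟨p, (hB _ (by simp only; omega)).trans hle, hm⟩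

theorem isLeftToRightMax_of_best {π : Equiv.Perm (Fin N)} {p : Fin N} (hp : (π p : ℕ) + 1 = N) :
    IsLeftToRightMax π p := by
  intro q hq
  refine lt_of_le_of_ne ?_ fun h => hq.ne (π.injective h)
  rw [Fin.le_def]
  omega

/-- The best candidate is a record, and no later record can follow it. -/
theorem best_iff_of_initial {π : Equiv.Perm (Fin N)} {i : Fin N}
    (h : ∀ p : Fin N, IsLeftToRightMax π p ↔ (p : ℕ) ≤ i) (p : Fin N) :
    (π p : ℕ) + 1 = N ↔ p = i := by
  have key : ∀ q : Fin N, (π q : ℕ) + 1 = N → q = i := by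
    intro q hq
    have hqi : q ≤ i := (h q).1 (isLeftToRightMax_of_best hq)
    refine hqi.eq_or_lt.resolve_right fun hlt => ?_
    have : (π q : ℕ) < π i := (h i).2 le_rfl q hlt
    omega
  refine ⟨key p, ?_⟩
  rintro rfl
  obtain ⟨q, hq⟩ := π.surjective ⟨N - 1, by have := p.2; omega⟩
  have hq' : (π q : ℕ) + 1 = N := by rw [hq]; have := p.2; simp only; omega
  rwa [key q hq'] at hq'

theorem selectionCount_eq_self {k : Fin s → ℕ} {π : Equiv.Perm (Fin N)} {n : ℕ} (hnN : n ≤ N)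
    (hns : n ≤ s) (hmax : ∀ p : Fin N, (p : ℕ) < n → IsLeftToRightMax π p)
    (hle : ∀ j : Fin s, (j : ℕ) < n → k j ≤ j) {m : ℕ} (hm : m ≤ n) :
    selectionCount k π m = m := by
  induction m with
  | zero => rfl
  | succ m ih =>
    rw [selectionCount, ih (by omega), if_pos]
    exact ⟨by omega, by omega, hle _ (by simp only; omega), hmax _ (by simp only; omega)⟩

theorem winnable_shiftThresholds_of_initial {k : Fin s → ℕ} {π : Equiv.Perm (Fin N)} {i : ℕ}
    (hiN : i < N) (hi : i < s) (hle : ∀ j : Fin s, (j : ℕ) < i → k j ≤ j)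
    (h : ∀ p : Fin N, IsLeftToRightMax π p ↔ (p : ℕ) ≤ i) : Winnable (shiftThresholds k) π := by
  have hle' : ∀ j : Fin s, (j : ℕ) ≤ i → shiftThresholds k j ≤ j := by
    intro j hj
    unfold shiftThresholds
    split_ifs with h0
    · exact Nat.zero_le _
    · refine (hle _ (by simp only; omega)).trans ?_
      simp
  refine ⟨⟨i, hiN⟩, ?_, (best_iff_of_initial (i := ⟨i, hiN⟩) h _).2 rfl⟩
  unfold Selects
  rw [selectionCount_eq_self (n := i) hiN.le hi.le (fun p hp => (h p).2 hp.le)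
    (fun j hj => hle' j hj.le) le_rfl]
  exact ⟨hi, hle' _ le_rfl, (h _).2 le_rfl⟩

theorem not_winnable_of_initial {k : Fin s → ℕ} {π : Equiv.Perm (Fin N)} {i : ℕ}
    (hiN : i < N) (hi : i < s) (hle : ∀ j : Fin s, (j : ℕ) < i → k j ≤ j) (hlt : i < k ⟨i, hi⟩)
    (h : ∀ p : Fin N, IsLeftToRightMax π p ↔ (p : ℕ) ≤ i) : ¬ Winnable k π := by
  rintro ⟨p, hsel, hp⟩
  rw [best_iff_of_initial (i := ⟨i, hiN⟩) h] at hp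
  subst hp
  unfold Selects at hsel
  rw [selectionCount_eq_self (n := i) hiN.le hi.le (fun p hp => (h p).2 hp.le) hle le_rfl] at hsel
  obtain ⟨_, hk, _⟩ := hsel
  simp only at hk
  omega

/-- The inequality holds permutation by permutation between indicators. -/
theorem winProb_add_le_winProb_shiftThresholds {θ : ℝ} (hθ : 1 < θ) {k : Fin s → ℕ}
    (hk : Monotone k) {i B : ℕ} (hB : ∀ i : Fin s, (i : ℕ) + 1 = s → B ≤ k i)
    (hiN : i < N) (hi : i < s) (hle : ∀ j : Fin s, (j : ℕ) < i → k j ≤ j) (hlt : i < k ⟨i, hi⟩) :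
    winProb θ N k +
      ∑ π : Equiv.Perm (Fin N) with ∀ p : Fin N, IsLeftToRightMax π p ↔ (p : ℕ) ≤ i,
        mallowsProb θ π ≤
    winProb θ N (shiftThresholds k) +
      ∑ π : Equiv.Perm (Fin N) with ∃ p : Fin N, B ≤ (p : ℕ) ∧ IsLeftToRightMax π p,
        mallowsProb θ π := by
  simp only [winProb, Finset.sum_filter]
  rw [← Finset.sum_add_distrib, ← Finset.sum_add_distrib]
  refine Finset.sum_le_sum fun π _ => ?_
  have h0 := mallowsProb_nonneg hθ π
  by_cases hE : ∀ p : Fin N, IsLeftToRightMax π p ↔ (p : ℕ) ≤ i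
  · rw [if_neg (not_winnable_of_initial hiN hi hle hlt hE), if_pos hE,
      if_pos (winnable_shiftThresholds_of_initial hiN hi hle hE), zero_add]
    split_ifs <;> linarith
  · rw [if_neg hE]
    by_cases hW : Winnable k π
    · rw [if_pos hW]
      rcases winnable_shiftThresholds_or hk hB hW with h | h
      · rw [if_pos h]; split_ifs <;> linarith
      · rw [if_pos h]; split_ifs <;> linarith
    · rw [if_neg hW]; split_ifs <;> linarith

end Strategies

/-! ### Boundedness of the thresholds. -/

theorem mainTheorem7 (θ : ℝ) (hθ : 1 < θ) (s : ℕ) (hs : 1 ≤ s)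
    (k : ℕ → Fin s → ℕ) (hk : ∀ N, Monotone (k N)) (hopt : AsymptoticallyOptimal θ k) :
    ∃ B : ℕ, ∀ N : ℕ, ∀ i : Fin s, k N i ≤ B := by
  obtain ⟨δ, hδ, M, hM⟩ := exists_le_sum_mallowsProb_initial hθ s
  -- The loss and the optimality slack are each at most `δ / 4`, together less than the gain `δ`.
  obtain ⟨B, hB⟩ := exists_sum_recordProb_le hθ (ε := δ / 4) (by linarith)
  obtain ⟨N₀, hN₀⟩ := Filter.eventually_atTop.1 (hopt (δ / 4) (by linarith))
  have hlarge : ∀ N, max (max M s) N₀ ≤ N → ∀ i, k N i ≤ max B s := by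
    intro N hN i
    by_contra! hi
    have hlast : max B s < k N ⟨s - 1, by omega⟩ :=
      hi.trans_le (hk N (by rw [Fin.le_def]; simp only; omega))
    have hex : ∃ j, ∃ hj : j < s, j < k N ⟨j, hj⟩ :=
      ⟨s - 1, by omega, by have := le_max_right B s; omega⟩
    classical
    obtain ⟨hj, hlt⟩ := Nat.find_spec hex
    have hle : ∀ j' : Fin s, (j' : ℕ) < Nat.find hex → k N j' ≤ j' := by
      intro j' hj'
      have := Nat.find_min hex hj'
      push Not at this
      exact this j'.2
    have hgain := winProb_add_le_winProb_shiftThresholds (N := N) hθ (hk N) (B := B)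
      (fun i' hi' => by
        have : i' = ⟨s - 1, by omega⟩ := Fin.ext (by simp only; omega)
        rw [this]
        exact (le_max_left B s).trans hlast.le)
      (by omega) hj hle hlt
    have h1 := hM N (by omega) _ hj
    have h2 := (sum_mallowsProb_exists_le hθ N B).trans (hB B N le_rfl)
    have h3 := hN₀ N (by omega) _ (monotone_shiftThresholds (hk N))
    linarith
  -- The finitely many small `N` are covered by the maximum of their thresholds.
  refine ⟨max (max B s) ((range (max (max M s) N₀)).sup fun N => univ.sup (k N)), fun N i => ?_⟩
  by_cases hN : max (max M s) N₀ ≤ N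
  · exact (hlarge N hN i).trans (le_max_left _ _)
  · refine le_trans ?_ (le_max_right _ _)
    exact (Finset.le_sup (f := k N) (mem_univ i)).trans
      (Finset.le_sup (f := fun N => univ.sup (k N)) (mem_range.2 (not_le.1 hN)))
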